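/- Consider a single-resource loss network (stochastic knapsack) with capacity $b>0$ and classes $i=1,\dots,m$; class $i$ has Poisson arrival rate $\lambda_i>0$, exponential service rate $\mu_i>0$, load $\rho_i=\lambda_i/\mu_i$, capacity request $b_i>0$ and reward rate $r_i\ge 0$ per unit time, where at least one $r_i$ is positive. For $\kappa>0$ let $\mathrm{LP}(\kappa)$ be the linear program: maximize $\sum_i r_i\rho_i\alpha_i$ subject to $\sum_i b_i\rho_i\alpha_i\le\kappa$ and $0\le\alpha_i\le1$ for all $i$. Its dual is: minimize $u\kappa+\sum_i v_i$ subject to $v_i+b_i\rho_i u\ge r_i\rho_i$ and $v_i\ge0$ for all $i$, and $u\ge0$. Let $R^*$ be the optimal value of $\mathrm{LP}(b)$, let $(u^*,\mathbf v^*)$ be an optimal solution of the dual of $\mathrm{LP}(b)$, and let $$\varepsilon_0=\sup\{\varepsilon\ge0:\ (u^*,\mathbf v^*)\text{ is optimal for the dual of }\mathrm{LP}(b/(1+4\varepsilon))\}\in[0,\infty].$$ Let $0<\varepsilon<\min\{\varepsilon_0,\tfrac14\}$, let $\alpha^\varepsilon$ be an optimal solution of $\mathrm{LP}(b/(1+4\varepsilon))$,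 put $c_i^0=(1+4\varepsilon)\alpha_i^\varepsilon b_i\rho_i$ and $c_i^1=(1+4\varepsilon)(1-\alpha_i^\varepsilon)b_i\rho_i$, and let $\beta>0$ satisfy $$\beta\le\varepsilon\min\Big\{\min_{1\le i\le m}\frac{c_i^0}{b_i},\ \min_{i:\,\alpha_i^\varepsilon<1}\frac{c_i^1}{b_i}\Big\}$$ (a minimum over the empty set is $+\infty$). Let $\zeta=\big(\frac{\log 2}{\beta}+1-\frac\varepsilon2\big)(1+4\varepsilon)-1$ and, for $t\ge0$, $$L(t)=\max\Big\{\sum_{i=1}^m\alpha_i^\varepsilon r_i\rho_i(1-e^{-\mu_i t})-\zeta\sum_{i=1}^m(1-\alpha_i^\varepsilon)r_i\rho_i-2e^{-\varepsilon(\beta-4)/2}\sum_{i=1}^m r_i\rho_i(1-e^{-\mu_i t}),\ 0\Big\}.$$ Then $\bar L=\lim_{t\to\infty}L(t)$ exists and $$\frac{\bar L}{R^*}\ \ge\ 1-12\varepsilon-\frac{2\log 2}{\beta}-\Big(2e^{-\varepsilon(\beta-4)/2}+8\varepsilon+\frac{2\log 2}{\beta}\Big)\frac{\sum_{i=1}^m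 r_i\rho_i}{R^*}.$$ -/

import Mathlib

open Filter Topology

noncomputable section

/-- The single-resource loss network (stochastic knapsack): `m` Poisson arrival classes; class `i` has
arrival rate `lam i`, exponential service times of rate `mu i`, capacity request `req i` and reward
rate `r i` per unit time; all classes share one resource of capacity `b`. -/
structure Knapsack (m : ℕ) where
  lam : Fin m → ℝ
  mu : Fin m → ℝ
  req : Fin m → ℝ
  r : Fin m → ℝ
  b : ℝ
  lam_pos : ∀ i, 0 < lam i
  mu_pos : ∀ i, 0 < mu i
  req_pos : ∀ i, 0 < req i
  r_nonneg : ∀ i, 0 ≤ r i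
  b_pos : 0 < b

namespace Knapsack

variable {m : ℕ} (K : Knapsack m)

/-- The load `ρ i = λ i / μ i` of class `i`. -/
def rho (i : Fin m) : ℝ := K.lam i / K.mu i

/-- The objective `∑ i, r i * ρ i * α i` of the linear programs. -/
def reward (α : Fin m → ℝ) : ℝ := ∑ i, K.r i * K.rho i * α i

/-- The feasible region of the linear program with capacity `κ`:
`∑ i, b i * ρ i * α i ≤ κ` and `0 ≤ α i ≤ 1`. -/
def feasible (κ : ℝ) : Set (Fin m → ℝ) :=
  {α | ∑ i, K.req i * K.rho i * α i ≤ κ ∧ ∀ i, 0 ≤ α i ∧ α i ≤ 1}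

/-- `α` is an optimal solution of the linear program with capacity `κ`. -/
def IsOptimal (κ : ℝ) (α : Fin m → ℝ) : Prop :=
  α ∈ K.feasible κ ∧ ∀ α' ∈ K.feasible κ, K.reward α' ≤ K.reward α

/-- `R*`, the optimal value of the steady-state linear program, which has capacity `b`. The set is
nonempty and bounded. -/
def Rstar : ℝ := sSup (K.reward '' K.feasible K.b)

/-- The capacity `b / (1 + 4 ε)` of the `ε`-perturbed steady-state linear program. -/
def perturbedCapacity (ε : ℝ) : ℝ := K.b / (1 + 4 * ε)

/-- Feasibility of `(u, v)` for the dual linear program (the same for every capacity `κ`):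
`v i + b i * ρ i * u ≥ r i * ρ i`, `v ≥ 0`, `u ≥ 0`. -/
def DualFeasible (u : ℝ) (v : Fin m → ℝ) : Prop :=
  (∀ i, K.r i * K.rho i ≤ v i + K.req i * K.rho i * u) ∧ (∀ i, 0 ≤ v i) ∧ 0 ≤ u

/-- `(u, v)` minimizes `u * κ + ∑ i, v i` over the dual feasible region, that is, it is an optimal
solution of the dual of the linear program with capacity `κ`. -/
def IsDualOptimal (κ u : ℝ) (v : Fin m → ℝ) : Prop :=
  K.DualFeasible u v ∧
    ∀ (u' : ℝ) (v' : Fin m → ℝ), K.DualFeasible u' v' → u * κ + ∑ i, v i ≤ u' * κ + ∑ i, v' i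

/-- `ε₀`: the largest `ε ≥ 0` for which `(u, v)` is optimal for the dual of the `ε`-perturbed linear
program. It is a supremum in the extended reals, since `(u, v)` can be optimal for all `ε`
(then `ε₀ = ∞`, for instance when no `v i` is positive and `u > 0`). -/
def eps0 (u : ℝ) (v : Fin m → ℝ) : EReal :=
  sSup ((fun ε : ℝ => (ε : EReal)) '' {ε : ℝ | 0 ≤ ε ∧ K.IsDualOptimal (K.perturbedCapacity ε) u v})

/-- The target capacity of class `i` in system 0. -/
def c0 (ε : ℝ) (α : Fin m → ℝ) (i : Fin m) : ℝ := (1 + 4 * ε) * α i * K.req i * K.rho i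

/-- The target capacity of class `i` in the fictitious system 1. -/
def c1 (ε : ℝ) (α : Fin m → ℝ) (i : Fin m) : ℝ := (1 + 4 * ε) * (1 - α i) * K.req i * K.rho i

/-- The bound on the multiplier `β`:
`β ≤ ε * min (min over all i of c⁰ i / b i) (min over {i | α i < 1} of c¹ i / b i)`,
where a minimum over the empty set imposes no constraint. -/
def BetaBound (ε : ℝ) (α : Fin m → ℝ) (β : ℝ) : Prop :=
  (∀ i, β ≤ ε * (K.c0 ε α i / K.req i)) ∧ (∀ i, α i < 1 → β ≤ ε * (K.c1 ε α i / K.req i))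

/-- The constant `ζ`. -/
def zeta (ε β : ℝ) : ℝ := (Real.log 2 / β + 1 - ε / 2) * (1 + 4 * ε) - 1

/-- The lower bound `L(t)` on the expected reward rate of the penalty policy at time `t`. -/
def L (ε β : ℝ) (α : Fin m → ℝ) (t : ℝ) : ℝ :=
  max
    (∑ i, α i * K.r i * K.rho i * (1 - Real.exp (-K.mu i * t))
      - zeta ε β * ∑ i, (1 - α i) * K.r i * K.rho i
      - 2 * Real.exp (-(ε / 2) * (β - 4)) * ∑ i, K.r i * K.rho i * (1 - Real.exp (-K.mu i * t)))
    0

end Knapsack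

end

/-! Write `A` for the reward of `α` and `S` for `∑ i, K.r i * K.rho i`. As t → ∞ every factor 1 -
exp(-μ t) tends to 1, so the limit is max(A - ζ (S - A) - 2 e^{-ε(β-4)/2} S, 0). Shrinking any
policy feasible for capacity `b` by 1/(1+4ε) makes it feasible for the perturbed program, so R* ≤
(1+4ε) A and hence A ≥ (1-4ε) R*. With 0 ≤ ζ ≤ 8ε + 2 log 2/β, the loss ζ (S - A) is at most (8ε + 2
log 2/β) S; dividing by R* > 0 gives the bound, with slack in the R* coefficient. -/

namespace Knapsack

variable {m : ℕ} (K : Knapsack m)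

theorem rho_pos (i : Fin m) : 0 < K.rho i := div_pos (K.lam_pos i) (K.mu_pos i)

theorem mul_rho_nonneg (i : Fin m) : 0 ≤ K.r i * K.rho i :=
  mul_nonneg (K.r_nonneg i) (K.rho_pos i).le

theorem reward_nonneg {κ : ℝ} {α : Fin m → ℝ} (hα : α ∈ K.feasible κ) : 0 ≤ K.reward α :=
  Finset.sum_nonneg fun i _ => mul_nonneg (K.mul_rho_nonneg i) (hα.2 i).1

theorem reward_le_sum {κ : ℝ} {α : Fin m → ℝ} (hα : α ∈ K.feasible κ) :
    K.reward α ≤ ∑ i, K.r i * K.rho i :=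
  Finset.sum_le_sum fun i _ => mul_le_of_le_one_right (K.mul_rho_nonneg i) (hα.2 i).2

theorem bddAbove_reward (κ : ℝ) : BddAbove (K.reward '' K.feasible κ) := by
  refine ⟨∑ i, K.r i * K.rho i, ?_⟩
  rintro _ ⟨α, hα, rfl⟩
  exact K.reward_le_sum hα

theorem reward_mul_const (c : ℝ) (α : Fin m → ℝ) :
    K.reward (fun i => α i * c) = K.reward α * c := by
  simp only [reward, Finset.sum_mul, mul_assoc]

theorem zero_mem_feasible : (0 : Fin m → ℝ) ∈ K.feasible K.b :=
  ⟨by simpa using K.b_pos.le, fun _ => by simp⟩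

/-- Scaling a policy by `c ∈ [0, 1]` keeps it feasible for the capacity scaled by `c`. -/
theorem mul_const_mem_feasible {κ c : ℝ} (hc : 0 ≤ c) (hc1 : c ≤ 1) {α : Fin m → ℝ}
    (hα : α ∈ K.feasible κ) : (fun i => α i * c) ∈ K.feasible (κ * c) := by
  refine ⟨?_, fun i => ⟨mul_nonneg (hα.2 i).1 hc, mul_le_one₀ (hα.2 i).2 hc hc1⟩⟩
  have h := mul_le_mul_of_nonneg_right hα.1 hc
  simpa only [Finset.sum_mul, mul_assoc] using h

theorem Rstar_pos (hr : ∃ i, 0 < K.r i) : 0 < K.Rstar := by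
  obtain ⟨j, hj⟩ := hr
  have hS : 0 < ∑ i, K.r i * K.rho i :=
    Finset.sum_pos' (fun i _ => K.mul_rho_nonneg i) ⟨j, Finset.mem_univ j, mul_pos hj (K.rho_pos j)⟩
  have hT : 0 < ∑ i, K.req i * K.rho i :=
    Finset.sum_pos (fun i _ => mul_pos (K.req_pos i) (K.rho_pos i)) ⟨j, Finset.mem_univ j⟩
  -- The largest constant policy that is feasible for capacity `b`.
  set δ : ℝ := min 1 (K.b / ∑ i, K.req i * K.rho i) with hδ
  have hδ0 : 0 < δ := lt_min one_pos (div_pos K.b_pos hT)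
  have hmem : (fun _ => δ) ∈ K.feasible K.b := by
    refine ⟨?_, fun _ => ⟨hδ0.le, min_le_left _ _⟩⟩
    rw [← Finset.sum_mul, mul_comm, ← le_div_iff₀ hT]
    exact min_le_right _ _
  have hle : K.reward (fun _ => δ) ≤ K.Rstar :=
    le_csSup (K.bddAbove_reward K.b) ⟨_, hmem, rfl⟩
  refine lt_of_lt_of_le ?_ hle
  rw [reward, ← Finset.sum_mul]
  exact mul_pos hS hδ0

theorem Rstar_le_mul_reward {ε : ℝ} (hε : 0 ≤ ε) {α : Fin m → ℝ}
    (hα : K.IsOptimal (K.perturbedCapacity ε) α) : K.Rstar ≤ K.reward α * (1 + 4 * ε) := by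
  have hpos : 0 < 1 + 4 * ε := by positivity
  refine csSup_le ⟨_, 0, K.zero_mem_feasible, rfl⟩ ?_
  rintro _ ⟨α', hα', rfl⟩
  have hmem := K.mul_const_mem_feasible (inv_nonneg.2 hpos.le)
    (inv_le_one_of_one_le₀ (by linarith)) hα'
  have h := hα.2 _ hmem
  rwa [K.reward_mul_const, ← div_eq_mul_inv, div_le_iff₀ hpos] at h

theorem tendsto_L (ε β : ℝ) (α : Fin m → ℝ) :
    Tendsto (K.L ε β α) atTop
      (𝓝 (max (K.reward α - zeta ε β * ((∑ i, K.r i * K.rho i) - K.reward α)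
        - 2 * Real.exp (-(ε / 2) * (β - 4)) * ∑ i, K.r i * K.rho i) 0)) := by
  have hexp (i : Fin m) : Tendsto (fun t => 1 - Real.exp (-K.mu i * t)) atTop (𝓝 1) := by
    have h : Tendsto (fun t => -K.mu i * t) atTop atBot :=
      tendsto_id.const_mul_atTop_of_neg (neg_lt_zero.2 (K.mu_pos i))
    simpa using (Real.tendsto_exp_atBot.comp h).const_sub 1
  have hsum (a : Fin m → ℝ) :
      Tendsto (fun t => ∑ i, a i * (1 - Real.exp (-K.mu i * t))) atTop (𝓝 (∑ i, a i)) := by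
    simpa using tendsto_finsetSum Finset.univ fun i _ => (hexp i).const_mul (a i)
  have hA : K.reward α = ∑ i, α i * K.r i * K.rho i :=
    Finset.sum_congr rfl fun i _ => by ring
  have hB : (∑ i, K.r i * K.rho i) - K.reward α = ∑ i, (1 - α i) * K.r i * K.rho i := by
    rw [reward, ← Finset.sum_sub_distrib]
    exact Finset.sum_congr rfl fun i _ => by ring
  rw [hB, hA]
  exact (((hsum _).sub_const _).sub ((hsum _).const_mul _)).max tendsto_const_nhds

/-- With l = log 2/β, expanding gives ζ = l (1+4ε) + 7ε/2 - 2ε². For ε ≤ 1/4 the quadratic term is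
absorbed by 7ε/2, and in `zeta_le` l (1+4ε) ≤ 2l. -/
theorem zeta_nonneg {ε β : ℝ} (hε : 0 ≤ ε) (hε' : ε ≤ 1 / 4) (hβ : 0 < β) : 0 ≤ zeta ε β := by
  have hl : 0 ≤ Real.log 2 / β := div_nonneg (Real.log_nonneg one_le_two) hβ.le
  unfold zeta
  nlinarith [mul_nonneg hl hε, mul_nonneg hε (sub_nonneg.2 hε')]

theorem zeta_le {ε β : ℝ} (hε : 0 ≤ ε) (hε' : ε ≤ 1 / 4) (hβ : 0 < β) :
    zeta ε β ≤ 8 * ε + 2 * Real.log 2 / β := by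
  have hl : 0 ≤ Real.log 2 / β := div_nonneg (Real.log_nonneg one_le_two) hβ.le
  rw [mul_div_assoc]
  unfold zeta
  nlinarith [mul_nonneg hl (sub_nonneg.2 hε'), mul_nonneg hε hε]

end Knapsack

open Knapsack in
theorem corollary1 {m : ℕ} (K : Knapsack m) (hr : ∃ i, 0 < K.r i)
    (ustar : ℝ) (vstar : Fin m → ℝ) (hdual : K.IsDualOptimal K.b ustar vstar)
    (ε : ℝ) (hε_pos : 0 < ε) (hε : (ε : EReal) < min (K.eps0 ustar vstar) ((1 / 4 : ℝ) : EReal))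
    (α : Fin m → ℝ) (hα : K.IsOptimal (K.perturbedCapacity ε) α)
    (β : ℝ) (hβ_pos : 0 < β) (hβ : K.BetaBound ε α β) :
    ∃ Lbar : ℝ, Tendsto (K.L ε β α) atTop (𝓝 Lbar) ∧
      Lbar / K.Rstar ≥
        1 - 12 * ε - 2 * Real.log 2 / β
          - (2 * Real.exp (-(ε / 2) * (β - 4)) + 8 * ε + 2 * Real.log 2 / β)
            * ((∑ i, K.r i * K.rho i) / K.Rstar) := by
  have hε4 : ε ≤ 1 / 4 := (EReal.coe_lt_coe_iff.1 (lt_min_iff.1 hε).2).le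
  refine ⟨_, K.tendsto_L ε β α, ?_⟩
  have hR := K.Rstar_pos hr
  have hA := K.reward_nonneg hα.1
  have hAR := K.Rstar_le_mul_reward hε_pos.le hα
  have hAS := K.reward_le_sum hα.1
  have hl : 0 ≤ 2 * Real.log 2 / β := by positivity
  have hz := zeta_nonneg hε_pos.le hε4 hβ_pos
  have hz' := zeta_le hε_pos.le hε4 hβ_pos
  rw [ge_iff_le, le_div_iff₀ hR, sub_mul, mul_assoc _ (_ / _), div_mul_cancel₀ _ hR.ne']
  refine le_trans ?_ (le_max_left _ _)
  generalize (∑ i, K.r i * K.rho i) = S at *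
  have hS : 0 ≤ S := hA.trans hAS
  have hlow : (1 - 12 * ε - 2 * Real.log 2 / β) * K.Rstar ≤ K.reward α := by
    have h1 : (1 - 4 * ε) * K.Rstar ≤ K.reward α := by
      -- (1-4ε) R* ≤ (1-4ε)(1+4ε) A = (1-16ε²) A ≤ A.
      nlinarith [mul_le_mul_of_nonneg_left hAR (by linarith : 0 ≤ 1 - 4 * ε),
        mul_nonneg hA (sq_nonneg ε)]
    nlinarith [mul_nonneg hl hR.le, mul_nonneg hε_pos.le hR.le]
  -- Since ζ A ≥ 0, the loss ζ (S - A) is at most ζ S.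
  nlinarith [mul_le_mul_of_nonneg_right hz' hS, mul_nonneg hz hA]
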